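/- Let $\mathcal{A}_{A_3}$ be the Artin group of type $A_3$ (the braid group on 4 strands), that is, the group with presentation $$\mathcal{A}_{A_3}=\langle a_1,a_2,a_3 \;:\; a_1a_2a_1=a_2a_1a_2,\ a_2a_3a_2=a_3a_2a_3,\ a_1a_3=a_3a_1\rangle .$$ Then the commutator subgroup $\mathcal{A}_{A_3}'=[\mathcal{A}_{A_3},\mathcal{A}_{A_3}]$ is isomorphic to a semidirect product of two free groups, each of rank $2$: there is a homomorphism $\varphi\colon F_2\to\operatorname{Aut}(F_2)$ such that $$\mathcal{A}_{A_3}'\;\cong\; F_2\rtimes_{\varphi}F_2 .$$ -/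

import Mathlib

/-- The alternating product `⟨ab⟩^q = a b a ⋯` with `q` factors, starting with `a`. -/
def alternatingProd {G : Type*} [Monoid G] (a b : G) : ℕ → G
  | 0 => 1
  | q + 1 => a * alternatingProd b a q

/-- The defining relators `⟨ab⟩^m (⟨ba⟩^m)⁻¹`, `m = m_{ab} < ∞`, of the Artin group of a Coxeter
matrix. In Mathlib's `CoxeterMatrix` the entry `0` stands for `∞`. -/
def CoxeterMatrix.artinRelators {S : Type*} (M : CoxeterMatrix S) : Set (FreeGroup S) :=
  {r | ∃ s t : S, M s t ≠ 0 ∧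
    r = alternatingProd (FreeGroup.of s) (FreeGroup.of t) (M s t) *
      (alternatingProd (FreeGroup.of t) (FreeGroup.of s) (M s t))⁻¹}

/-- The Artin group of a Coxeter matrix: generators `S`, relations `⟨ab⟩^m = ⟨ba⟩^m` whenever
`m = m_{ab} < ∞`. -/
abbrev CoxeterMatrix.ArtinGroup {S : Type*} (M : CoxeterMatrix S) : Type _ :=
  PresentedGroup M.artinRelators

/-!
The braid group `B₄` maps onto `B₃` by `a₁, a₂, a₃ ↦ a₁, a₂, a₁`, this map is split, and its
kernel is free on `x = a₃a₁⁻¹` and `y = a₂xa₂⁻¹`. In the same way `B₃` maps onto `ℤ` with kernel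
free on `u = a₂a₁⁻¹` and `v = a₁ua₁⁻¹`. So `B₄` should be the iterated semidirect product
`F(x, y) ⋊ (F(u, v) ⋊ ℤ)`, in which the generator `t` of `ℤ` is `a₁`.

Instead of computing the kernels, the proof builds this iterated semidirect product from explicit
automorphisms of the free group `F₂` (`shiftAut` for `t` acting on `F(u, v)`; `firstAut` and
`secondAut` for `a₁` and `a₂` acting on `F(x, y)`) and gives homomorphisms in both directions that
are mutually inverse on generators (`artinEquivModel`). That the actions are well defined comes down
to the braid relation between `firstAut` and `secondAut`.

The commutator subgroup of the model is the kernel of the projection to `ℤ`: one inclusion holds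
because `ℤ` is commutative, the other because the four free generators die in every commutative
quotient (`comp_fiberInclusion_eq_one`). This kernel is `F(x, y) ⋊ F(u, v)`.
-/

open SemidirectProduct

/-! ### Homomorphisms out of semidirect products -/

/-- The compatibility condition of `SemidirectProduct.lift` need only be checked on a generating
set of the acting group. -/
theorem SemidirectProduct.lift_compat_of_closure {N K G : Type*} [Group N] [Group K] [Group G]
    {φ : K →* MulAut N} {f : N →* G} {g : K →* G} {s : Set K} (hs : Subgroup.closure s = ⊤)
    (h : ∀ k ∈ s, f.comp (φ k).toMonoidHom = (MulAut.conj (g k)).toMonoidHom.comp f) (k : K) :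
    f.comp (φ k).toMonoidHom = (MulAut.conj (g k)).toMonoidHom.comp f := by
  suffices ∀ n, f (φ k n) = g k * f n * (g k)⁻¹ by ext n; simpa using this n
  have hk : k ∈ Subgroup.closure s := hs ▸ Subgroup.mem_top k
  induction hk using Subgroup.closure_induction with
  | mem k hk => intro n; simpa using DFunLike.congr_fun (h k hk) n
  | one => simp
  | mul k l _ _ hk hl => intro n; simp [hk, hl, mul_assoc]
  | inv k _ hk =>
    intro n
    have := hk (φ k⁻¹ n)
    rw [← MulAut.mul_apply, ← map_mul, mul_inv_cancel, map_one, MulAut.one_apply] at this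
    rw [this]; simp [mul_assoc]

theorem Multiplicative.closure_ofAdd_one :
    Subgroup.closure {Multiplicative.ofAdd (1 : ℤ)} = ⊤ := by
  refine (Subgroup.eq_top_iff' _).2 fun n ↦ Subgroup.mem_closure_singleton.2 ⟨n.toAdd, ?_⟩
  rw [← ofAdd_zsmul]; simp

theorem FreeGroup.hom_ext_fin_two {G : Type*} [Group G] {f g : FreeGroup (Fin 2) →* G}
    (h0 : f (FreeGroup.of 0) = g (FreeGroup.of 0))
    (h1 : f (FreeGroup.of 1) = g (FreeGroup.of 1)) : f = g :=
  FreeGroup.ext_hom _ _ (Fin.forall_fin_two.2 ⟨h0, h1⟩)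

/-! ### Automorphisms of the free group of rank two -/

/-- The automorphism `u ↦ v`, `v ↦ u⁻¹v` of the free group on `u, v`: the conjugation by `a₁` on
the commutator subgroup of the braid group on three strands. -/
def shiftAut : MulAut (FreeGroup (Fin 2)) :=
  MonoidHom.toMulEquiv
    (FreeGroup.lift ![FreeGroup.of 1, (FreeGroup.of 0)⁻¹ * FreeGroup.of 1])
    (FreeGroup.lift ![FreeGroup.of 0 * (FreeGroup.of 1)⁻¹, FreeGroup.of 0])
    (by apply FreeGroup.hom_ext_fin_two <;> simp)
    (by apply FreeGroup.hom_ext_fin_two <;> simp)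

/-- The automorphism `x ↦ x`, `y ↦ x⁻¹y` of the free group on `x, y`: the conjugation by `a₁`. -/
def firstAut : MulAut (FreeGroup (Fin 2)) :=
  MonoidHom.toMulEquiv
    (FreeGroup.lift ![FreeGroup.of 0, (FreeGroup.of 0)⁻¹ * FreeGroup.of 1])
    (FreeGroup.lift ![FreeGroup.of 0, FreeGroup.of 0 * FreeGroup.of 1])
    (by apply FreeGroup.hom_ext_fin_two <;> simp)
    (by apply FreeGroup.hom_ext_fin_two <;> simp)

/-- The automorphism `x ↦ y`, `y ↦ yx⁻¹y` of the free group on `x, y`: the conjugation by `a₂`. -/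
def secondAut : MulAut (FreeGroup (Fin 2)) :=
  MonoidHom.toMulEquiv
    (FreeGroup.lift ![FreeGroup.of 1, FreeGroup.of 1 * (FreeGroup.of 0)⁻¹ * FreeGroup.of 1])
    (FreeGroup.lift ![FreeGroup.of 0 * (FreeGroup.of 1)⁻¹ * FreeGroup.of 0, FreeGroup.of 0])
    (by apply FreeGroup.hom_ext_fin_two <;> simp [mul_assoc])
    (by apply FreeGroup.hom_ext_fin_two <;> simp [mul_assoc])

@[simp] theorem shiftAut_of_zero : shiftAut (FreeGroup.of 0) = FreeGroup.of 1 := by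
  simp [shiftAut]

@[simp] theorem shiftAut_of_one :
    shiftAut (FreeGroup.of 1) = (FreeGroup.of 0)⁻¹ * FreeGroup.of 1 := by
  simp [shiftAut]

@[simp] theorem firstAut_of_zero : firstAut (FreeGroup.of 0) = FreeGroup.of 0 := by
  simp [firstAut]

@[simp] theorem firstAut_of_one :
    firstAut (FreeGroup.of 1) = (FreeGroup.of 0)⁻¹ * FreeGroup.of 1 := by
  simp [firstAut]

@[simp] theorem secondAut_of_zero : secondAut (FreeGroup.of 0) = FreeGroup.of 1 := by
  simp [secondAut]

@[simp] theorem secondAut_of_one :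
    secondAut (FreeGroup.of 1) = FreeGroup.of 1 * (FreeGroup.of 0)⁻¹ * FreeGroup.of 1 := by
  simp [secondAut]

theorem firstAut_secondAut_braid :
    firstAut * secondAut * firstAut = secondAut * firstAut * secondAut := by
  apply MulEquiv.toMonoidHom_injective
  apply FreeGroup.hom_ext_fin_two <;> simp [mul_assoc]

/-! ### The braid group on three strands as a semidirect product -/

/-- The semidirect product of the free group on `u, v` by `ℤ` acting through `shiftAut`; a model
of the braid group on three strands. -/
abbrev BraidThreeModel : Type :=
  FreeGroup (Fin 2) ⋊[zpowersHom (MulAut (FreeGroup (Fin 2))) shiftAut] Multiplicative ℤ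

namespace BraidThreeModel

/-- The generator `t` of `ℤ`, which corresponds to the standard generator `a₁`. -/
def first : BraidThreeModel := inr (Multiplicative.ofAdd 1)

/-- The element `ut`, which corresponds to the standard generator `a₂`. -/
def second : BraidThreeModel := inl (FreeGroup.of 0) * first

theorem first_mul_inl_mul_inv (n : FreeGroup (Fin 2)) :
    first * inl n * first⁻¹ = inl (shiftAut n) := by
  rw [first, ← map_inv, ← inl_aut]; simp

theorem inl_of_zero : (inl (FreeGroup.of 0) : BraidThreeModel) = second * first⁻¹ := by
  simp [second]

theorem inl_of_one :
    (inl (FreeGroup.of 1) : BraidThreeModel) = first * (second * first⁻¹) * first⁻¹ := by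
  rw [← inl_of_zero, first_mul_inl_mul_inv, shiftAut_of_zero]

theorem braid : first * second * first = second * first * second := by
  have h := first_mul_inl_mul_inv (FreeGroup.of 1)
  rw [shiftAut_of_one, map_mul, map_inv, inl_of_one, inl_of_zero] at h
  have h' := congrArg (fun z ↦ second * first⁻¹ * z * first * first * first) h
  simpa [mul_assoc] using h'.symm

/-- A pair `a, b` satisfying the braid relation defines a homomorphism from the model with
`t ↦ a` and `ut ↦ b`. -/
def lift {G : Type*} [Group G] (a b : G) (h : a * b * a = b * a * b) : BraidThreeModel →* G :=
  SemidirectProduct.lift (FreeGroup.lift ![b * a⁻¹, a * (b * a⁻¹) * a⁻¹]) (zpowersHom G a)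
    (lift_compat_of_closure Multiplicative.closure_ofAdd_one (by
      rintro _ rfl
      apply FreeGroup.hom_ext_fin_two
      · simp
      · have h' : a * b * a⁻¹ = b⁻¹ * a * b := by
          rw [mul_inv_eq_iff_eq_mul, mul_assoc, mul_assoc, eq_inv_mul_iff_mul_eq, ← mul_assoc,
            ← mul_assoc, ← h, mul_assoc]
        have := congrArg (fun z ↦ a * z * a⁻¹ * a⁻¹) h'
        simpa [mul_assoc] using this.symm))

variable {G : Type*} [Group G] (a b : G) (h : a * b * a = b * a * b)

@[simp] theorem lift_first : lift a b h first = a := by simp [lift, first]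

@[simp] theorem lift_second : lift a b h second = b := by simp [lift, first, second]

theorem hom_ext {f g : BraidThreeModel →* G} (h1 : f first = g first)
    (h2 : f second = g second) : f = g := by
  refine SemidirectProduct.hom_ext (FreeGroup.hom_ext_fin_two ?_ ?_) (MonoidHom.ext_mint h1)
  · simp [inl_of_zero, h1, h2]
  · simp [inl_of_one, h1, h2]

theorem closure_first_second : Subgroup.closure {first, second} = ⊤ := by
  set C := Subgroup.closure {first, second}
  have h1 : first ∈ C := Subgroup.subset_closure (by simp)
  have h2 : second ∈ C := Subgroup.subset_closure (by simp)
  -- The inclusion of `C` has a section, namely the homomorphism given by the generators in `C`.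
  let s : BraidThreeModel →* C := lift ⟨first, h1⟩ ⟨second, h2⟩ (Subtype.ext braid)
  have hs : C.subtype.comp s = MonoidHom.id _ := hom_ext (by simp [s]) (by simp [s])
  refine (Subgroup.eq_top_iff' _).2 fun k ↦ ?_
  have hk : (s k : BraidThreeModel) = k := DFunLike.congr_fun hs k
  exact hk ▸ (s k).2

end BraidThreeModel

/-! ### Consequences of the braid relations -/

section

variable {G : Type*} [Group G] {a b c : G}

/-- With `x = ca⁻¹` and `y = bxb⁻¹`, the relation `aya⁻¹ = x⁻¹y` expresses the braid relation
between `b` and `c`. -/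
theorem conj_eq_inv_mul_iff_braid (hab : a * b * a = b * a * b) :
    a * (b * (c * a⁻¹) * b⁻¹) * a⁻¹ = (c * a⁻¹)⁻¹ * (b * (c * a⁻¹) * b⁻¹) ↔
      b * c * b = c * b * c := by
  have hl : a * (b * (c * a⁻¹) * b⁻¹) * a⁻¹ = a * (b * c * b⁻¹) * (a⁻¹ * b⁻¹) := by
    calc _ = a * b * c * (a * b * a)⁻¹ := by group
      _ = _ := by rw [hab]; group
  have hr : (c * a⁻¹)⁻¹ * (b * (c * a⁻¹) * b⁻¹) = a * (c⁻¹ * b * c) * (a⁻¹ * b⁻¹) := by group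
  rw [hl, hr, mul_left_inj, mul_right_inj, mul_inv_eq_iff_eq_mul, mul_assoc c⁻¹, mul_assoc c⁻¹,
    eq_inv_mul_iff_mul_eq, eq_comm]
  simp only [mul_assoc]

/-- If `a` commutes with `x` and conjugates `y = bxb⁻¹` to `x⁻¹y`, and `a, b` satisfy the braid
relation, then `b` conjugates `y` to `yx⁻¹y`. -/
theorem conj_conj_eq_of_braid {x : G} (hab : a * b * a = b * a * b) (hx : a * x * a⁻¹ = x)
    (hy : a * (b * x * b⁻¹) * a⁻¹ = x⁻¹ * (b * x * b⁻¹)) :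
    b * (b * x * b⁻¹) * b⁻¹ = b * x * b⁻¹ * x⁻¹ * (b * x * b⁻¹) := by
  have h : (b * x * b⁻¹)⁻¹ * (b * (b * x * b⁻¹) * b⁻¹) = x⁻¹ * (b * x * b⁻¹) :=
    calc _ = b * (x⁻¹ * (b * x * b⁻¹)) * b⁻¹ := by group
      _ = (b * a * b) * x * (b * a * b)⁻¹ := by rw [← hy]; group
      _ = a * (b * (a * x * a⁻¹) * b⁻¹) * a⁻¹ := by rw [← hab]; group
      _ = _ := by rw [hx, hy]
  rw [inv_mul_eq_iff_eq_mul] at h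
  rw [h, ← mul_assoc]

end

/-! ### The braid group on four strands as an iterated semidirect product -/

/-- The action of the braid group on three strands on the free group on `x, y`. -/
def braidThreeAction : BraidThreeModel →* MulAut (FreeGroup (Fin 2)) :=
  BraidThreeModel.lift firstAut secondAut firstAut_secondAut_braid

@[simp] theorem braidThreeAction_first : braidThreeAction BraidThreeModel.first = firstAut :=
  BraidThreeModel.lift_first ..

@[simp] theorem braidThreeAction_second : braidThreeAction BraidThreeModel.second = secondAut :=
  BraidThreeModel.lift_second ..

/-- The semidirect product of the free group on `x, y` by the model of the braid group on three
strands; a model of the braid group on four strands. -/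
abbrev BraidFourModel : Type := FreeGroup (Fin 2) ⋊[braidThreeAction] BraidThreeModel

namespace BraidFourModel

/-- The element corresponding to `a₁`. -/
def first : BraidFourModel := inr BraidThreeModel.first

/-- The element corresponding to `a₂`. -/
def second : BraidFourModel := inr BraidThreeModel.second

/-- The element `xa₁`, which corresponds to `a₃`. -/
def third : BraidFourModel := inl (FreeGroup.of 0) * first

theorem first_mul_inl_mul_inv (n : FreeGroup (Fin 2)) :
    first * inl n * first⁻¹ = inl (firstAut n) := by
  rw [first, ← map_inv, ← inl_aut]; simp

theorem second_mul_inl_mul_inv (n : FreeGroup (Fin 2)) :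
    second * inl n * second⁻¹ = inl (secondAut n) := by
  rw [second, ← map_inv, ← inl_aut]; simp

theorem inl_of_zero : (inl (FreeGroup.of 0) : BraidFourModel) = third * first⁻¹ := by
  simp [third]

theorem inl_of_one :
    (inl (FreeGroup.of 1) : BraidFourModel) = second * (third * first⁻¹) * second⁻¹ := by
  rw [← inl_of_zero, second_mul_inl_mul_inv, secondAut_of_zero]

theorem first_second_braid : first * second * first = second * first * second := by
  simp only [first, second, ← map_mul, BraidThreeModel.braid]

theorem first_third_comm : first * third = third * first := by
  have h := first_mul_inl_mul_inv (FreeGroup.of 0)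
  rw [firstAut_of_zero, inl_of_zero] at h
  have h' := congrArg (fun z ↦ z * first * first) h
  simpa [mul_assoc] using h'

theorem second_third_braid : second * third * second = third * second * third := by
  rw [← conj_eq_inv_mul_iff_braid first_second_braid, ← inl_of_zero, second_mul_inl_mul_inv,
    secondAut_of_zero, first_mul_inl_mul_inv, firstAut_of_one, map_mul, map_inv]

/-- Three elements satisfying the relations of the braid group on four strands define a
homomorphism from the model. -/
def lift {G : Type*} [Group G] (a b c : G) (hab : a * b * a = b * a * b)
    (hbc : b * c * b = c * b * c) (hac : a * c = c * a) : BraidFourModel →* G :=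
  SemidirectProduct.lift (FreeGroup.lift ![c * a⁻¹, b * (c * a⁻¹) * b⁻¹])
    (BraidThreeModel.lift a b hab)
    (lift_compat_of_closure BraidThreeModel.closure_first_second (by
      have hy := (conj_eq_inv_mul_iff_braid hab).2 hbc
      rintro _ (rfl | rfl)
      · apply FreeGroup.hom_ext_fin_two
        · simp [← mul_assoc, hac]
        · simpa using hy.symm
      · apply FreeGroup.hom_ext_fin_two
        · simp
        · -- With `x = ca⁻¹` and `y = bxb⁻¹`, conjugating `x` by `bab = aba` in two ways gives
          -- `y⁻¹(byb⁻¹) = x⁻¹y`.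
          have hx : a * (c * a⁻¹) * a⁻¹ = c * a⁻¹ := by simp [← mul_assoc, hac]
          have := conj_conj_eq_of_braid hab hx hy
          simpa using this.symm))

section

variable {G : Type*} [Group G] (a b c : G) (hab : a * b * a = b * a * b)
    (hbc : b * c * b = c * b * c) (hac : a * c = c * a)

@[simp] theorem lift_first : lift a b c hab hbc hac first = a := by simp [lift, first]

@[simp] theorem lift_second : lift a b c hab hbc hac second = b := by simp [lift, second]

@[simp] theorem lift_third : lift a b c hab hbc hac third = c := by simp [lift, first, third]

theorem hom_ext {f g : BraidFourModel →* G} (h1 : f first = g first)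
    (h2 : f second = g second) (h3 : f third = g third) : f = g := by
  refine SemidirectProduct.hom_ext (FreeGroup.hom_ext_fin_two ?_ ?_)
    (BraidThreeModel.hom_ext h1 h2)
  · simp [inl_of_zero, h1, h3]
  · simp [inl_of_one, h1, h2, h3]

end

end BraidFourModel

/-- A homomorphism out of the Artin group of type `A₃`, from three elements satisfying the
defining relations. -/
def artinLift {G : Type*} [Group G] (a b c : G) (hab : a * b * a = b * a * b)
    (hbc : b * c * b = c * b * c) (hac : a * c = c * a) :
    (CoxeterMatrix.A 3).ArtinGroup →* G :=
  PresentedGroup.toGroup (f := ![a, b, c]) (by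
    rintro _ ⟨s, t, -, rfl⟩
    rw [map_mul, map_inv, mul_inv_eq_one]
    fin_cases s <;> fin_cases t <;>
      simp [CoxeterMatrix.A, alternatingProd, ← mul_assoc, hab, hbc, hac])

section

variable {G : Type*} [Group G] (a b c : G) (hab : a * b * a = b * a * b)
    (hbc : b * c * b = c * b * c) (hac : a * c = c * a)

@[simp] theorem artinLift_of_zero : artinLift a b c hab hbc hac (PresentedGroup.of 0) = a :=
  PresentedGroup.toGroup.of _

@[simp] theorem artinLift_of_one : artinLift a b c hab hbc hac (PresentedGroup.of 1) = b :=
  PresentedGroup.toGroup.of _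

@[simp] theorem artinLift_of_two : artinLift a b c hab hbc hac (PresentedGroup.of 2) = c :=
  PresentedGroup.toGroup.of _

end

namespace CoxeterMatrix.ArtinGroup

variable {S : Type*} {M : CoxeterMatrix S} {s t : S}

theorem mk_alternatingProd_eq (h : M s t ≠ 0) :
    PresentedGroup.mk M.artinRelators
        (alternatingProd (FreeGroup.of s) (FreeGroup.of t) (M s t)) =
      PresentedGroup.mk M.artinRelators
        (alternatingProd (FreeGroup.of t) (FreeGroup.of s) (M s t)) :=
  PresentedGroup.mk_eq_mk_of_mul_inv_mem ⟨s, t, h, rfl⟩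

theorem of_mul_comm (h : M s t = 2) :
    (PresentedGroup.of s * PresentedGroup.of t : M.ArtinGroup) =
      PresentedGroup.of t * PresentedGroup.of s := by
  have := mk_alternatingProd_eq (M := M) (s := s) (t := t) (by simp [h])
  simp only [h, alternatingProd, map_mul, mul_one] at this
  exact this

theorem of_braid (h : M s t = 3) :
    (PresentedGroup.of s * PresentedGroup.of t * PresentedGroup.of s : M.ArtinGroup) =
      PresentedGroup.of t * PresentedGroup.of s * PresentedGroup.of t := by
  have := mk_alternatingProd_eq (M := M) (s := s) (t := t) (by simp [h])
  simp only [h, alternatingProd, map_mul, mul_one, ← mul_assoc] at this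
  exact this

end CoxeterMatrix.ArtinGroup

/-- The Artin group of type `A₃` is isomorphic to the iterated semidirect product. -/
def artinEquivModel : (CoxeterMatrix.A 3).ArtinGroup ≃* BraidFourModel :=
  MonoidHom.toMulEquiv
    (artinLift BraidFourModel.first BraidFourModel.second BraidFourModel.third
      BraidFourModel.first_second_braid BraidFourModel.second_third_braid
      BraidFourModel.first_third_comm)
    (BraidFourModel.lift (PresentedGroup.of 0) (PresentedGroup.of 1) (PresentedGroup.of 2)
      (CoxeterMatrix.ArtinGroup.of_braid (by simp [CoxeterMatrix.A]))
      (CoxeterMatrix.ArtinGroup.of_braid (by simp [CoxeterMatrix.A]))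
      (CoxeterMatrix.ArtinGroup.of_mul_comm (by simp [CoxeterMatrix.A])))
    (PresentedGroup.ext fun i ↦ by fin_cases i <;> simp)
    (BraidFourModel.hom_ext (by simp) (by simp) (by simp))

/-! ### The commutator subgroup -/

/-- The action of the free group on `u, v` on the free group on `x, y`. -/
def freeAction : FreeGroup (Fin 2) →* MulAut (FreeGroup (Fin 2)) :=
  braidThreeAction.comp inl

/-- The inclusion of `F(x, y) ⋊ F(u, v)` into `F(x, y) ⋊ (F(u, v) ⋊ ℤ)`. -/
def fiberInclusion : FreeGroup (Fin 2) ⋊[freeAction] FreeGroup (Fin 2) →* BraidFourModel :=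
  SemidirectProduct.map (MonoidHom.id _) inl fun _ ↦ rfl

theorem fiberInclusion_injective : Function.Injective fiberInclusion := fun _ _ h ↦
  SemidirectProduct.ext (congrArg (fun p : BraidFourModel ↦ p.left) h)
    (inl_injective (congrArg (fun p : BraidFourModel ↦ p.right) h))

/-- A homomorphism to a commutative group kills `x, y, u, v`: their images satisfy `y = x⁻¹y` and
`x = y`, and likewise `v = u⁻¹v` and `u = v`. -/
theorem comp_fiberInclusion_eq_one {A : Type*} [CommGroup A] (q : BraidFourModel →* A) :
    q.comp fiberInclusion = 1 := by
  have hconj (k : BraidThreeModel) (n : FreeGroup (Fin 2)) :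
      q (inl (braidThreeAction k n)) = q (inl n) := by
    rw [inl_aut, map_mul, map_mul, map_inv, map_inv, mul_inv_cancel_comm]
  have hconj' (n : FreeGroup (Fin 2)) : q (inr (inl (shiftAut n))) = q (inr (inl n)) := by
    rw [← BraidThreeModel.first_mul_inl_mul_inv]
    simp only [map_mul, map_inv, mul_inv_cancel_comm]
  have hx : q (inl (FreeGroup.of 0)) = 1 := by
    simpa using hconj BraidThreeModel.first (FreeGroup.of 1)
  have hy : q (inl (FreeGroup.of 1)) = 1 := by
    simpa [hx] using hconj BraidThreeModel.second (FreeGroup.of 0)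
  have hu : q (inr (inl (FreeGroup.of 0))) = 1 := by
    simpa using hconj' (FreeGroup.of 1)
  have hv : q (inr (inl (FreeGroup.of 1))) = 1 := by
    simpa [hu] using hconj' (FreeGroup.of 0)
  refine SemidirectProduct.hom_ext ?_ ?_ <;> apply FreeGroup.hom_ext_fin_two
  · exact hx
  · exact hy
  · exact hu
  · exact hv

theorem range_fiberInclusion : fiberInclusion.range = commutator BraidFourModel := by
  apply le_antisymm
  · rw [← Abelianization.ker_of, MonoidHom.range_le_ker_iff]
    exact comp_fiberInclusion_eq_one _
  · intro p hp
    have hp' : p.right.right = 1 :=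
      Abelianization.commutator_subset_ker (rightHom.comp rightHom) hp
    exact ⟨⟨p.left, p.right.left⟩,
      SemidirectProduct.ext rfl (SemidirectProduct.ext rfl hp'.symm)⟩

theorem MulEquiv.map_commutator_eq {G H : Type*} [Group G] [Group H] (e : G ≃* H) :
    (commutator G).map e.toMonoidHom = commutator H := by
  rw [commutator, Subgroup.map_commutator, ← MonoidHom.range_eq_map,
    MonoidHom.range_eq_top.2 e.surjective, commutator]

theorem mainTheorem7 :
    ∃ φ : FreeGroup (Fin 2) →* MulAut (FreeGroup (Fin 2)),
      Nonempty (commutator (CoxeterMatrix.A 3).ArtinGroup ≃*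
        FreeGroup (Fin 2) ⋊[φ] FreeGroup (Fin 2)) :=
  ⟨freeAction, ⟨(artinEquivModel.subgroupMap _).trans
    ((MulEquiv.subgroupCongr
      (artinEquivModel.map_commutator_eq.trans range_fiberInclusion.symm)).trans
        (MonoidHom.ofInjective fiberInclusion_injective).symm)⟩⟩
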